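/- **Corollary 4.3.** *Setting.* Let $L$ be a second-order language (function symbols and relation symbols of all arities), with infinitely many individual variables $x,y,\dots$ and, for every $n\ge 0$, infinitely many $n$-ary relation variables $X,Y,\dots$, and let $E$ be a set of equations between terms of $L$. Types are the second-order formulas of $L$ built from atomic formulas $X(t_1,\dots,t_n)$, where $X$ is a relation variable or a relation symbol, with $\to$, $\forall x$, $\forall X$; they are taken up to renaming of bound variables. Let $\Lambda$ be the set of pure $\lambda$-terms. *Positive and negative types.* The types $\forall^+$ and $\forall^-$ are defined together: atomic formulas are both; if $B$ is $\forall^-$ and $A$ is $\forall^+$, then $B\to A$ is $\forall^+$; if $B$ is $\forall^+$ and $A$ is $\forall^-$ and does not begin with a first-order quantifier, then $B\to A$ is $\forall^-$; if $A$ is $\forall^+$ and $X$ occurs free in $A$, then $\forall X A$ is $\forall^+$; if $A$ is $\forall^-$, then $\forall x A$ is $\forall^-$. *Order and equivalence on types.* Let $\le$ be the reflexive transitive closure of the relation given by $\forall x A <' A[u/x]$ ($u$ a term) and $\forall X A <' A[F/X(x_1,\dots,x_n)]$ ($F$ a formula, $X$ of arity $n$); write $A<B$ if $A\le B$ and $A\ne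 B$. Let $\sim$ be the reflexive transitive closure of the relation that holds between $C[u/x]$ and $C[v/x]$ whenever $u=v$ or $v=u$ is a substitution instance of an equation of $E$. *Sub-types.* Give each occurrence of a quantifier in $A$ its own infinite set of variables (of the kind that it binds), these sets being pairwise disjoint and disjoint from the free variables of $A$. Every type is a positive sub-type of itself, and an atomic type is also a negative sub-type of itself. Further, the positive (resp. negative) sub-types of $B\to C$ include the negative (resp. positive) sub-types of $B$ and the positive (resp. negative) sub-types of $C$; those of $\forall\xi B$ ($\xi$ an individual or a relation variable) include those of $B[\eta/\xi]$ for each variable $\eta$ of the set given to this quantifier. There are no others. A sub-type with substitution is a type $S[t_1/x_1,\dots,t_k/x_k]$ where $S$ is a sub-type and $t_1,\dots,t_k$ are terms. *Good positive types.* A type $A$ is $\mathcal B^+$ if it is $\forall^+$ and there are no negative sub-types with substitution $B$, $C$ of $A$ and no types $G,C_1,\dots,C_n,D$ ($n\ge1$) such that $B<G$, $G\sim C_n$ and $C\le C_1\to(C_2\to(\cdots\to(C_n\to D)\cdots))$. *Models.* A set $G\subseteq\Lambda$ is saturated if $u\in G$ and $t\to_\beta u$ imply $t\in G$, where $\to_\beta$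 is $\beta$-reduction in any finite number of steps. Put $G\to G'=\{u : (u)t\in G' \text{ for all } t\in G\}$. A set $R$ of saturated sets is adequate if it is closed under $\to$ and under arbitrary intersections (so $\Lambda\in R$, as the empty intersection). A $\Lambda_\beta$-model $M$ of $L$ consists of a non-empty set $|M|$, an adequate set $R$, a function $f_M:|M|^n\to|M|$ for each $n$-ary function symbol $f$, and a function $P_M:|M|^n\to R$ for each $n$-ary relation symbol $P$. Individual variables take values in $|M|$ and $n$-ary relation variables take values in $R^{|M|^n}$. Atomic formulas are evaluated as usual, $|A\to B|=|A|\to|B|$, $|\forall xA|$ is the intersection of the values of $A$ over all values of $x$ in $|M|$, and $|\forall XA|$ is the intersection of the values of $A$ over all values of $X$ in $R^{|M|^n}$. $M$ is a model of $E$ if both sides of every equation of $E$ have the same value in $M$ for all values of their variables. For a closed type $A$, let $|A|_\beta\subseteq\Lambda$ be the intersection of the values of $A$ in all $\Lambda_\beta$-models of $E$. *Statement.* Let $A$ be a closed $\mathcal B^+$ type. (i) Every $t\in|A|_\beta$ is normalizable (it $\beta$-reduces to a $\beta$-normal term), and it $\beta$-reduces to a closed term. (ii) $|A|_\beta$ is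 closed under $\beta$-equivalence: if $t\in|A|_\beta$ and $t\simeq_\beta t'$, then $t'\in|A|_\beta$. -/

import Mathlib

universe u v w

namespace AF2

/-! ### The pure lambda-calculus -/

/-- Terms of the pure lambda-calculus up to renaming of bound variables (de Bruijn indices;
an index that points outside all abstractions is a free variable). -/
inductive Lam : Type
  | var (n : ℕ) : Lam
  | app (t u : Lam) : Lam
  | lam (t : Lam) : Lam

namespace Lam

/-- A renaming, pushed under an abstraction. -/
def upRen (ρ : ℕ → ℕ) : ℕ → ℕ
  | 0 => 0
  | k + 1 => ρ k + 1

def rename (ρ : ℕ → ℕ) : Lam → Lam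
  | var n => var (ρ n)
  | app t u => app (t.rename ρ) (u.rename ρ)
  | lam t => lam (t.rename (upRen ρ))

/-- A substitution, pushed under an abstraction. -/
def upSub (σ : ℕ → Lam) : ℕ → Lam
  | 0 => var 0
  | k + 1 => (σ k).rename Nat.succ

/-- Simultaneous capture-avoiding substitution. -/
def subst (σ : ℕ → Lam) : Lam → Lam
  | var n => σ n
  | app t u => app (t.subst σ) (u.subst σ)
  | lam t => lam (t.subst (upSub σ))

/-- The substitution replacing the variable `0` by `u` and lowering the other variables. -/
def single (u : Lam) : ℕ → Lam
  | 0 => u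
  | k + 1 => var k

/-- The set of free variables. -/
def Fv : Lam → Set ℕ
  | var n => {n}
  | app t u => t.Fv ∪ u.Fv
  | lam t => {k | k + 1 ∈ t.Fv}

def Closed (t : Lam) : Prop := t.Fv = ∅

/-- One step of beta-reduction, in any context. -/
inductive BetaStep : Lam → Lam → Prop
  | beta (t u : Lam) : BetaStep (app (lam t) u) (t.subst (single u))
  | appL {t t' : Lam} (u : Lam) : BetaStep t t' → BetaStep (app t u) (app t' u)
  | appR (t : Lam) {u u' : Lam} : BetaStep u u' → BetaStep (app t u) (app t u')
  | lam {t t' : Lam} : BetaStep t t' → BetaStep (lam t) (lam t')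

/-- Beta-reduction (any finite number of steps, possibly none). -/
def BetaRed : Lam → Lam → Prop := Relation.ReflTransGen BetaStep

/-- Beta-equivalence. -/
def BetaEq : Lam → Lam → Prop := Relation.EqvGen BetaStep

def Normal (t : Lam) : Prop := ∀ u, ¬ BetaStep t u

def Normalizable (t : Lam) : Prop := ∃ u, BetaRed t u ∧ Normal u

end Lam

/-! ### Second-order formulas -/

/-- Second-order formulas over the language `L` (the types of the system), up to renaming of
bound variables. There are individual variables `0, 1, …` and, for every arity `n`, relation
variables `0, 1, …`. Quantifiers use de Bruijn indices: `all1` binds the individual variable `0`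
of its body and `all2 n` the `n`-ary relation variable `0` of its body. -/
inductive Form (L : FirstOrder.Language.{u, v}) : Type (max u v)
  | rel {n : ℕ} (P : L.Relations n) (ts : Fin n → L.Term ℕ) : Form L
  | rvar (n : ℕ) (X : ℕ) (ts : Fin n → L.Term ℕ) : Form L
  | imp (A B : Form L) : Form L
  | all1 (A : Form L) : Form L
  | all2 (n : ℕ) (A : Form L) : Form L

namespace Form

variable {L : FirstOrder.Language.{u, v}}

def IsAtomic : Form L → Prop
  | rel _ _ => True
  | rvar _ _ _ => True
  | _ => False

/-- The formula starts with a first-order quantifier. -/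
def StartsAll1 : Form L → Prop
  | all1 _ => True
  | _ => False

/-- The individual variable `x` is free in the formula. -/
def FreeI : ℕ → Form L → Prop
  | x, rel _ ts => ∃ i, x ∈ (ts i).varFinset
  | x, rvar _ _ ts => ∃ i, x ∈ (ts i).varFinset
  | x, imp A B => FreeI x A ∨ FreeI x B
  | x, all1 A => FreeI (x + 1) A
  | x, all2 _ A => FreeI x A

/-- The `n`-ary relation variable `X` is free in the formula. -/
def FreeR (n : ℕ) : ℕ → Form L → Prop
  | _, rel _ _ => False
  | X, rvar m Y _ => m = n ∧ Y = X
  | X, imp A B => FreeR n X A ∨ FreeR n X B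
  | X, all1 A => FreeR n X A
  | X, all2 m A => FreeR n (if m = n then X + 1 else X) A

def Closed (A : Form L) : Prop := (∀ x, ¬ A.FreeI x) ∧ ∀ n X, ¬ A.FreeR n X

/-- A substitution of terms for individual variables, pushed under a first-order quantifier. -/
def upI (σ : ℕ → L.Term ℕ) : ℕ → L.Term ℕ
  | 0 => .var 0
  | k + 1 => (σ k).relabel Nat.succ

/-- Simultaneous capture-avoiding substitution of terms for individual variables. -/
def substI (σ : ℕ → L.Term ℕ) : Form L → Form L
  | rel P ts => rel P fun i => (ts i).subst σ
  | rvar n X ts => rvar n X fun i => (ts i).subst σ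
  | imp A B => imp (A.substI σ) (B.substI σ)
  | all1 A => all1 (A.substI (upI σ))
  | all2 n A => all2 n (A.substI σ)

/-- The substitution replacing the individual variable `0` by `u` and lowering the others. -/
def singleI (u : L.Term ℕ) : ℕ → L.Term ℕ
  | 0 => u
  | k + 1 => .var k

/-- `A[u/x]`, where `x` is the individual variable `0` of `A`. -/
def instI (A : Form L) (u : L.Term ℕ) : Form L := A.substI (singleI u)

/-- A renaming of relation variables, pushed under a quantifier on `n`-ary relations. -/
def upRenR (n : ℕ) (ρ : ℕ → ℕ → ℕ) : ℕ → ℕ → ℕ :=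
  Function.update ρ n fun X => X.casesOn 0 fun k => ρ n k + 1

/-- Capture-avoiding renaming of relation variables (`ρ n` acts on those of arity `n`). -/
def renR (ρ : ℕ → ℕ → ℕ) : Form L → Form L
  | rel P ts => rel P ts
  | rvar n X ts => rvar n (ρ n X) ts
  | imp A B => imp (A.renR ρ) (B.renR ρ)
  | all1 A => all1 (A.renR ρ)
  | all2 n A => all2 n (A.renR (upRenR n ρ))

/-- `A[Y/X]`, where `X` is the `n`-ary relation variable `0` of `A` and `Y` an `n`-ary relation
variable. -/
def instRV (n : ℕ) (A : Form L) (Y : ℕ) : Form L :=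
  A.renR (Function.update (fun _ X => X) n fun X => X.casesOn Y fun k => k)

/-- In a formula `F` that abbreviates `F(x₁, …, xₙ)`, the parameters `x₁, …, xₙ` are the
individual variables `0, …, n - 1`, and the variable `k + n` stands for the variable `k` of
the surrounding formula. `plug n ts` puts terms for the parameters. -/
def plug (n : ℕ) (ts : Fin n → L.Term ℕ) (x : ℕ) : L.Term ℕ :=
  if h : x < n then ts ⟨x, h⟩ else .var (x - n)

/-- A substitution for relation variables, pushed under a first-order quantifier. -/
def upSubR1 (τ : ℕ → ℕ → Form L) : ℕ → ℕ → Form L :=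
  fun n X => (τ n X).substI fun x => if x < n then .var x else .var (x + 1)

/-- A substitution for relation variables, pushed under a quantifier on `n`-ary relations. -/
def upSubR2 (n : ℕ) (τ : ℕ → ℕ → Form L) : ℕ → ℕ → Form L :=
  let shift : ℕ → ℕ → Form L := fun m X =>
    (τ m X).renR (Function.update (fun _ Y => Y) n Nat.succ)
  Function.update shift n fun X =>
    X.casesOn (rvar n 0 fun i => .var i) fun k => shift n k

/-- Simultaneous capture-avoiding substitution of formulas with parameters for relation variables:
`X(t₁, …, tₙ)` becomes `F[t₁/x₁, …, tₙ/xₙ]` with `F = τ n X`. -/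
def substR (τ : ℕ → ℕ → Form L) : Form L → Form L
  | rel P ts => rel P ts
  | rvar n X ts => (τ n X).substI (plug n ts)
  | imp A B => imp (A.substR τ) (B.substR τ)
  | all1 A => all1 (A.substR (upSubR1 τ))
  | all2 n A => all2 n (A.substR (upSubR2 n τ))

/-- `A[F/X(x₁, …, xₙ)]`, where `X` is the `n`-ary relation variable `0` of `A`. -/
def instR (n : ℕ) (A F : Form L) : Form L :=
  A.substR (Function.update (fun m X => rvar m X fun i => .var i) n fun X =>
    X.casesOn F fun k => rvar n k fun i => .var i)

/-! ### The order and the equational equivalence on types -/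

/-- One instantiation of a leading quantifier. -/
inductive InstStep : Form L → Form L → Prop
  | ind (A : Form L) (u : L.Term ℕ) : InstStep (all1 A) (A.instI u)
  | rel (n : ℕ) (A F : Form L) : InstStep (all2 n A) (instR n A F)

/-- `A ≤ B`. -/
def Le : Form L → Form L → Prop := Relation.ReflTransGen InstStep

/-- `A < B`. -/
def Lt (A B : Form L) : Prop := Le A B ∧ A ≠ B

/-- `u = v` is a particular case of an equation of `E`, read in either direction. -/
def IsCase (E : Set (L.Term ℕ × L.Term ℕ)) (a b : L.Term ℕ) : Prop :=
  ∃ e ∈ E, ∃ σ : ℕ → L.Term ℕ,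
    (a = e.1.subst σ ∧ b = e.2.subst σ) ∨ (a = e.2.subst σ ∧ b = e.1.subst σ)

/-- `A = C[a/x]` and `B = C[b/x]`, where `a = b` is a particular case of an equation of `E`. -/
def EqStep (E : Set (L.Term ℕ × L.Term ℕ)) (A B : Form L) : Prop :=
  ∃ (C : Form L) (a b : L.Term ℕ), IsCase E a b ∧ A = C.instI a ∧ B = C.instI b

/-- `A ∼ B`. -/
def Sim (E : Set (L.Term ℕ × L.Term ℕ)) : Form L → Form L → Prop :=
  Relation.ReflTransGen (EqStep E)

/-! ### Good positive types -/

mutual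
/-- Positive types. -/
inductive IsPos : Form L → Prop
  | atom {A : Form L} : A.IsAtomic → IsPos A
  | imp {B A : Form L} : IsNeg B → IsPos A → IsPos (imp B A)
  | all2 {n : ℕ} {A : Form L} : A.FreeR n 0 → IsPos A → IsPos (all2 n A)
/-- Negative types. -/
inductive IsNeg : Form L → Prop
  | atom {A : Form L} : A.IsAtomic → IsNeg A
  | imp {B A : Form L} : IsPos B → IsNeg A → ¬ A.StartsAll1 → IsNeg (imp B A)
  | all1 {A : Form L} : IsNeg A → IsNeg (all1 A)
end

/-- A choice of names for the bound variables of `A`: every position `p` of the syntax tree of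
`A` has its own infinite set `{V p i | i ∈ ℕ}` of variables, these sets are pairwise disjoint, and
none of these variables is free in `A`. -/
def NameSupply (A : Form L) (V : List Bool → ℕ → ℕ) : Prop :=
  (Function.Injective fun q : List Bool × ℕ => V q.1 q.2) ∧
    ∀ p i, ¬ A.FreeI (V p i) ∧ ∀ n, ¬ A.FreeR n (V p i)

/-- `SubTy V b p A S`: for the formula `A` standing at position `p`, `S` is a positive (`b = true`)
or negative (`b = false`) sub-type of `A`. A variable bound at position `p` may be replaced by
any of the variables `V p i`. -/
inductive SubTy (V : List Bool → ℕ → ℕ) : Bool → List Bool → Form L → Form L → Prop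
  | self (p : List Bool) (A : Form L) : SubTy V true p A A
  | atom (p : List Bool) (A : Form L) : A.IsAtomic → SubTy V false p A A
  | impL {b : Bool} {p : List Bool} {B C S : Form L} :
      SubTy V (!b) (false :: p) B S → SubTy V b p (imp B C) S
  | impR {b : Bool} {p : List Bool} {B C S : Form L} :
      SubTy V b (true :: p) C S → SubTy V b p (imp B C) S
  | all1 {b : Bool} {p : List Bool} {B S : Form L} (i : ℕ) :
      SubTy V b (true :: p) (B.instI (.var (V p i))) S → SubTy V b p (all1 B) S
  | all2 {b : Bool} {p : List Bool} {n : ℕ} {B S : Form L} (i : ℕ) :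
      SubTy V b (true :: p) (instRV n B (V p i)) S → SubTy V b p (all2 n B) S

/-- Negative sub-types with substitution of `A`. -/
def NegSub (V : List Bool → ℕ → ℕ) (A B : Form L) : Prop :=
  ∃ (S : Form L) (σ : ℕ → L.Term ℕ), SubTy V false [] A S ∧ B = S.substI σ

/-- The condition (*) for a positive type `A`. All choices of names for the bound variables
give the same condition. The list `Cs` is `C₁, …, Cₙ₋₁`, with `n ≥ 1`. -/
def Star (E : Set (L.Term ℕ × L.Term ℕ)) (A : Form L) : Prop :=
  ∃ V, NameSupply A V ∧ ∀ B C, NegSub V A B → NegSub V A C →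
    ¬ ∃ (G : Form L) (Cs : List (Form L)) (Cn D : Form L),
      Lt B G ∧ Sim E G Cn ∧ Le C (Cs.foldr imp (imp Cn D))

/-- Good positive types, with respect to the system of equations `E`. -/
def IsGoodPos (E : Set (L.Term ℕ × L.Term ℕ)) (A : Form L) : Prop := A.IsPos ∧ A.Star E

end Form

/-! ### Models with sets of lambda-terms as truth values -/

/-- Sets of lambda-terms that are closed under beta-expansion. -/
def Saturated (G : Set Lam) : Prop := ∀ t u : Lam, u ∈ G → t.BetaRed u → t ∈ G

/-- `G → G'`. -/
def arrow (G G' : Set Lam) : Set Lam := {u | ∀ t ∈ G, Lam.app u t ∈ G'}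

/-- Adequate sets of saturated sets. -/
structure Adequate (R : Set (Set Lam)) : Prop where
  saturated : ∀ G ∈ R, Saturated G
  arrow_mem : ∀ G ∈ R, ∀ G' ∈ R, arrow G G' ∈ R
  sInter_mem : ∀ S ⊆ R, ⋂₀ S ∈ R

/-- The models of the language `L` whose truth values are saturated sets of lambda-terms. -/
structure Model (L : FirstOrder.Language.{u, v}) where
  Base : Type w
  nonempty : Nonempty Base
  R : Set (Set Lam)
  adequate : Adequate R
  func : ∀ {n : ℕ}, L.Functions n → (Fin n → Base) → Base
  rel : ∀ {n : ℕ}, L.Relations n → (Fin n → Base) → R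

namespace Model

variable {L : FirstOrder.Language.{u, v}}

/-- Interpretations of the individual variables. -/
abbrev IntI (M : Model.{u, v, w} L) : Type w := ℕ → M.Base

/-- Interpretations of the relation variables. -/
abbrev IntR (M : Model.{u, v, w} L) : Type w := ∀ n : ℕ, ℕ → (Fin n → M.Base) → M.R

/-- The value of a term. -/
def termVal (M : Model.{u, v, w} L) (I : M.IntI) : L.Term ℕ → M.Base
  | .var x => I x
  | .func f ts => M.func f fun i => M.termVal I (ts i)

/-- `I[x ← a]`, where `x` is the variable `0` of the body of a quantifier. -/
def pushI (M : Model.{u, v, w} L) (a : M.Base) (I : M.IntI) : M.IntI :=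
  fun x => x.casesOn a I

/-- `J[X ← Φ]`, where `X` is the `n`-ary variable `0` of the body of a quantifier. -/
def pushR (M : Model.{u, v, w} L) (n : ℕ) (Φ : (Fin n → M.Base) → M.R) (J : M.IntR) : M.IntR :=
  Function.update J n fun X => X.casesOn Φ (J n)

/-- The value of a formula. -/
def val (M : Model.{u, v, w} L) : Form L → M.IntI → M.IntR → Set Lam
  | .rel P ts, I, _ => M.rel P fun i => M.termVal I (ts i)
  | .rvar n X ts, I, J => J n X fun i => M.termVal I (ts i)
  | .imp A B, I, J => arrow (M.val A I J) (M.val B I J)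
  | .all1 A, I, J => ⋂ a : M.Base, M.val A (M.pushI a I) J
  | .all2 n A, I, J => ⋂ Φ : (Fin n → M.Base) → M.R, M.val A I (M.pushR n Φ J)

/-- `M` is a model of `E`: both sides of every equation have the same value in `M`, for all
values of the variables. -/
def Satisfies (M : Model.{u, v, w} L) (E : Set (L.Term ℕ × L.Term ℕ)) : Prop :=
  ∀ e ∈ E, ∀ I : M.IntI, M.termVal I e.1 = M.termVal I e.2

end Model

/-- The set `|A|_β`, for a closed type `A`: the intersection of the values of `A` in all models of
`E` (with base in the universe `w`). As `A` is closed, its value in a model is the same for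
all interpretations of the variables. -/
def betaVal {L : FirstOrder.Language.{u, v}} (E : Set (L.Term ℕ × L.Term ℕ)) (A : Form L) :
    Set Lam :=
  {t | ∀ M : Model.{u, v, w} L, M.Satisfies E → ∀ (I : M.IntI) (J : M.IntR), t ∈ M.val A I J}

end AF2

namespace AF2

namespace Lam

/-! ### Substitution lemmas -/

-- Fix a model `M` of `E` and read free variables as names: a map `σ` assigns a term to each
-- variable so that every term has a name. On the same base, build a second model whose truth values
-- are all saturated sets. An atomic formula with value `G` in `M` now takes as value the terms that
-- reduce to a normal term which, once its names are replaced by what they name, lies in `G`. The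
-- base and the functions are those of `M`, so the equations still hold.
--
-- As in a normalization proof by reducibility, induction on types (`namedModel_val`) carries this
-- reading from atomic formulas to all positive types, while for negative types normal
-- non-abstractions named in the old value lie in the new one. Two devices complete the definition.
-- The variable `j` is a wildcard, exempt from the membership condition, so that functions can be
-- applied to something even when the domain has an empty value in `M`. The variables in `bad` may
-- not occur in the normal form.
--
-- Let `t` be a uniform element of a positive type, and let `bad` contain its free variables. The
-- normal form of `t` has free variables only among those of `t`, yet none in `bad`, so it is
-- closed. Hence `σ` leaves it unchanged and it belongs to the value of the type in `M` itself. This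
-- gives (i). For (ii), by confluence a term equivalent to `t` reduces to the same normal form, and
-- values are saturated.

theorem rename_eq_subst (t : Lam) (ρ : ℕ → ℕ) : t.rename ρ = t.subst fun k => var (ρ k) := by
  induction t generalizing ρ with
  | var n => rfl
  | app t u iht ihu => simp only [rename, subst, iht, ihu]
  | lam t ih =>
    simp only [rename, subst, ih]
    congr 2
    funext k
    cases k <;> rfl

theorem subst_congr {t : Lam} {σ τ : ℕ → Lam} (h : ∀ k ∈ t.Fv, σ k = τ k) :
    t.subst σ = t.subst τ := by
  induction t generalizing σ τ with
  | var n => exact h n rfl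
  | app t u iht ihu =>
    simp only [subst]
    rw [iht fun k hk => h k (Or.inl hk), ihu fun k hk => h k (Or.inr hk)]
  | lam t ih =>
    simp only [subst]
    rw [ih]
    intro k hk
    cases k with
    | zero => rfl
    | succ k => simp only [upSub, h k hk]

theorem subst_var (t : Lam) : t.subst var = t := by
  induction t with
  | var n => rfl
  | app t u iht ihu => simp only [subst, iht, ihu]
  | lam t ih =>
    have h : upSub var = var := by funext k; cases k <;> rfl
    simp only [subst, h, ih]

theorem Closed.subst_eq {t : Lam} (h : t.Closed) (σ : ℕ → Lam) : t.subst σ = t := by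
  conv_rhs => rw [← subst_var t]
  refine subst_congr fun k hk => ?_
  rw [Closed] at h
  simp [h] at hk

theorem subst_rename (t : Lam) (ρ : ℕ → ℕ) (σ : ℕ → Lam) :
    (t.rename ρ).subst σ = t.subst fun k => σ (ρ k) := by
  induction t generalizing ρ σ with
  | var n => rfl
  | app t u iht ihu => simp only [rename, subst, iht, ihu]
  | lam t ih =>
    simp only [rename, subst, ih]
    congr 2
    funext k
    cases k <;> rfl

theorem rename_rename (t : Lam) (ρ ρ' : ℕ → ℕ) :
    (t.rename ρ).rename ρ' = t.rename fun k => ρ' (ρ k) := by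
  rw [rename_eq_subst (t.rename ρ), subst_rename, rename_eq_subst]

theorem rename_subst (t : Lam) (σ : ℕ → Lam) (ρ : ℕ → ℕ) :
    (t.subst σ).rename ρ = t.subst fun k => (σ k).rename ρ := by
  induction t generalizing ρ σ with
  | var n => rfl
  | app t u iht ihu => simp only [rename, subst, iht, ihu]
  | lam t ih =>
    simp only [rename, subst, ih]
    congr 2
    funext k
    cases k with
    | zero => rfl
    | succ k => simp only [upSub, rename_rename]; rfl

theorem subst_subst (t : Lam) (σ τ : ℕ → Lam) :
    (t.subst σ).subst τ = t.subst fun k => (σ k).subst τ := by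
  induction t generalizing σ τ with
  | var n => rfl
  | app t u iht ihu => simp only [subst, iht, ihu]
  | lam t ih =>
    simp only [subst, ih]
    congr 2
    funext k
    cases k with
    | zero => rfl
    | succ k => simp only [upSub, subst_rename, rename_subst]

theorem subst_single_subst (t u : Lam) (σ : ℕ → Lam) :
    (t.subst (single u)).subst σ = (t.subst (upSub σ)).subst (single (u.subst σ)) := by
  rw [subst_subst, subst_subst]
  congr 1
  funext k
  cases k with
  | zero => rfl
  | succ k =>
    simp only [single, upSub, subst_rename, subst]
    exact (subst_var (σ k)).symm

/-- Contracting a redex whose argument is a variable merely renames the body, so it affects neither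
normality nor reductions. -/
theorem subst_single_var (t : Lam) (y : ℕ) :
    t.subst (single (var y)) = t.rename fun k => k.casesOn y fun i => i := by
  rw [rename_eq_subst]
  congr 1
  funext k
  cases k <;> rfl

theorem subst_single_rename (t u : Lam) (ρ : ℕ → ℕ) :
    (t.subst (single u)).rename ρ = (t.rename (upRen ρ)).subst (single (u.rename ρ)) := by
  rw [rename_subst, subst_rename]
  congr 1
  funext k
  cases k <;> rfl

/-! ### Free variables -/

theorem mem_Fv_rename {t : Lam} {ρ : ℕ → ℕ} {k : ℕ} :
    k ∈ (t.rename ρ).Fv ↔ ∃ i ∈ t.Fv, ρ i = k := by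
  induction t generalizing ρ k with
  | var n => simp [rename, Fv, eq_comm]
  | app t u iht ihu =>
    simp only [rename, Fv, Set.mem_union, iht, ihu]
    grind
  | lam t ih =>
    simp only [rename, Fv, Set.mem_ofPred_eq, ih]
    constructor
    · rintro ⟨i, hi, h⟩
      cases i with
      | zero => simp [upRen] at h
      | succ i => exact ⟨i, hi, by simpa [upRen] using h⟩
    · rintro ⟨i, hi, rfl⟩
      exact ⟨i + 1, hi, rfl⟩

theorem mem_Fv_subst {t : Lam} {σ : ℕ → Lam} {k : ℕ} (h : k ∈ (t.subst σ).Fv) :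
    ∃ i ∈ t.Fv, k ∈ (σ i).Fv := by
  induction t generalizing σ k with
  | var n => exact ⟨n, rfl, h⟩
  | app t u iht ihu =>
    rcases h with h | h
    · obtain ⟨i, hi, hk⟩ := iht h
      exact ⟨i, Or.inl hi, hk⟩
    · obtain ⟨i, hi, hk⟩ := ihu h
      exact ⟨i, Or.inr hi, hk⟩
  | lam t ih =>
    obtain ⟨i, hi, hk⟩ := ih (k := k + 1) h
    cases i with
    | zero => simp [upSub, Fv] at hk
    | succ i =>
      obtain ⟨l, hl, e⟩ := mem_Fv_rename.1 hk
      obtain rfl : l = k := by simpa using e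
      exact ⟨i, hi, hl⟩

theorem finite_Fv (t : Lam) : t.Fv.Finite := by
  induction t with
  | var n => exact Set.finite_singleton n
  | app t u iht ihu => exact iht.union ihu
  | lam t ih => exact ih.preimage (f := fun k => k + 1) (add_left_injective 1).injOn

theorem BetaStep.Fv_subset {t u : Lam} (h : BetaStep t u) : u.Fv ⊆ t.Fv := by
  induction h with
  | beta t u =>
    intro k hk
    obtain ⟨i, hi, hk⟩ := mem_Fv_subst hk
    cases i with
    | zero => exact Or.inr hk
    | succ i =>
      obtain rfl : k = i := hk
      exact Or.inl hi
  | appL u _ ih => exact Set.union_subset_union_left _ ih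
  | appR t _ ih => exact Set.union_subset_union_right _ ih
  | lam _ ih => exact fun k hk => ih hk

theorem BetaRed.Fv_subset {t u : Lam} (h : t.BetaRed u) : u.Fv ⊆ t.Fv := by
  induction h with
  | refl => exact subset_rfl
  | tail _ h ih => exact h.Fv_subset.trans ih

/-! ### Beta-reduction in contexts and under substitutions -/

theorem BetaRed.appL {t t' : Lam} (u : Lam) (h : t.BetaRed t') : (app t u).BetaRed (app t' u) :=
  Relation.ReflTransGen.lift (fun s => app s u) (fun _ _ => BetaStep.appL u) _ _ h

theorem BetaRed.appR (t : Lam) {u u' : Lam} (h : u.BetaRed u') : (app t u).BetaRed (app t u') :=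
  Relation.ReflTransGen.lift (app t) (fun _ _ => BetaStep.appR t) _ _ h

theorem BetaRed.lam {t t' : Lam} (h : t.BetaRed t') : (lam t).BetaRed (lam t') :=
  Relation.ReflTransGen.lift Lam.lam (fun _ _ => BetaStep.lam) _ _ h

theorem BetaStep.subst {t u : Lam} (h : BetaStep t u) (σ : ℕ → Lam) :
    BetaStep (t.subst σ) (u.subst σ) := by
  induction h generalizing σ with
  | beta t u =>
    rw [subst_single_subst]
    exact .beta _ _
  | appL u _ ih => exact .appL _ (ih σ)
  | appR t _ ih => exact .appR _ (ih σ)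
  | lam _ ih => exact .lam (ih _)

theorem BetaRed.subst {t u : Lam} (h : t.BetaRed u) (σ : ℕ → Lam) :
    (t.subst σ).BetaRed (u.subst σ) :=
  Relation.ReflTransGen.lift (Lam.subst σ) (fun _ _ h => BetaStep.subst h σ) _ _ h

theorem BetaStep.rename {t u : Lam} (h : BetaStep t u) (ρ : ℕ → ℕ) :
    BetaStep (t.rename ρ) (u.rename ρ) := by
  rw [rename_eq_subst, rename_eq_subst]
  exact h.subst _

/-- A renaming, injective or not, creates no redex: an application whose head becomes an abstraction
already had an abstraction there. -/
theorem BetaStep.of_rename {t u : Lam} {ρ : ℕ → ℕ} (h : BetaStep (t.rename ρ) u) :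
    ∃ t', BetaStep t t' ∧ u = t'.rename ρ := by
  induction t generalizing ρ u with
  | var n => cases h
  | app t s iht ihs =>
    cases t with
    | var n =>
      cases h with
      | appL _ h => cases h
      | appR _ h =>
        obtain ⟨s', hs, rfl⟩ := ihs h
        exact ⟨_, .appR _ hs, rfl⟩
    | app t₁ t₂ =>
      cases h with
      | appL _ h =>
        obtain ⟨t', ht, rfl⟩ := iht h
        exact ⟨_, .appL _ ht, rfl⟩
      | appR _ h =>
        obtain ⟨s', hs, rfl⟩ := ihs h
        exact ⟨_, .appR _ hs, rfl⟩
    | lam r =>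
      cases h with
      | beta => exact ⟨_, .beta r s, (subst_single_rename r s ρ).symm⟩
      | appL _ h =>
        obtain ⟨t', ht, rfl⟩ := iht h
        exact ⟨_, .appL _ ht, rfl⟩
      | appR _ h =>
        obtain ⟨s', hs, rfl⟩ := ihs h
        exact ⟨_, .appR _ hs, rfl⟩
  | lam t ih =>
    cases h with
    | lam h =>
      obtain ⟨t', ht, rfl⟩ := ih h
      exact ⟨_, .lam ht, rfl⟩

theorem BetaRed.of_rename {t u : Lam} {ρ : ℕ → ℕ} (h : (t.rename ρ).BetaRed u) :
    ∃ t', t.BetaRed t' ∧ u = t'.rename ρ := by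
  induction h with
  | refl => exact ⟨t, .refl, rfl⟩
  | tail _ h ih =>
    obtain ⟨t', ht, rfl⟩ := ih
    obtain ⟨t'', ht', rfl⟩ := h.of_rename
    exact ⟨t'', ht.tail ht', rfl⟩

/-! ### The Church–Rosser theorem -/

/-- Parallel reduction. -/
inductive Par : Lam → Lam → Prop
  | var (n : ℕ) : Par (var n) (var n)
  | app {t t' u u' : Lam} : Par t t' → Par u u' → Par (app t u) (app t' u')
  | lam {t t' : Lam} : Par t t' → Par (lam t) (lam t')
  | beta {t t' u u' : Lam} : Par t t' → Par u u' →
      Par (Lam.app (Lam.lam t) u) (t'.subst (single u'))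

theorem Par.refl (t : Lam) : Par t t := by
  induction t with
  | var n => exact .var n
  | app t u iht ihu => exact .app iht ihu
  | lam t ih => exact .lam ih

theorem BetaStep.par {t u : Lam} (h : BetaStep t u) : Par t u := by
  induction h with
  | beta t u => exact .beta (.refl t) (.refl u)
  | appL u _ ih => exact .app ih (.refl u)
  | appR t _ ih => exact .app (.refl t) ih
  | lam _ ih => exact .lam ih

theorem Par.betaRed {t u : Lam} (h : Par t u) : t.BetaRed u := by
  induction h with
  | var n => exact .refl
  | app _ _ iht ihu => exact (iht.appL _).trans (ihu.appR _)
  | lam _ ih => exact ih.lam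
  | beta _ _ iht ihu => exact ((iht.lam.appL _).trans (ihu.appR _)).tail (.beta _ _)

theorem Par.rename {t u : Lam} (h : Par t u) (ρ : ℕ → ℕ) : Par (t.rename ρ) (u.rename ρ) := by
  induction h generalizing ρ with
  | var n => exact .var _
  | app _ _ iht ihu => exact .app (iht ρ) (ihu ρ)
  | lam _ ih => exact .lam (ih _)
  | beta _ _ iht ihu =>
    rw [subst_single_rename]
    exact .beta (iht _) (ihu ρ)

theorem Par.upSub {σ τ : ℕ → Lam} (h : ∀ k, Par (σ k) (τ k)) (k : ℕ) :
    Par (upSub σ k) (upSub τ k) := by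
  cases k with
  | zero => exact .var 0
  | succ k => exact (h k).rename _

theorem Par.subst {t u : Lam} (h : Par t u) {σ τ : ℕ → Lam} (hσ : ∀ k, Par (σ k) (τ k)) :
    Par (t.subst σ) (u.subst τ) := by
  induction h generalizing σ τ with
  | var n => exact hσ n
  | app _ _ iht ihu => exact .app (iht hσ) (ihu hσ)
  | lam _ ih => exact .lam (ih (Par.upSub hσ))
  | beta _ _ iht ihu =>
    rw [subst_single_subst]
    exact .beta (iht (Par.upSub hσ)) (ihu hσ)

theorem Par.subst_single {t t' u u' : Lam} (ht : Par t t') (hu : Par u u') :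
    Par (t.subst (single u)) (t'.subst (single u')) := by
  refine ht.subst fun k => ?_
  cases k with
  | zero => exact hu
  | succ k => exact .var k

/-- The contraction of all redexes of a term. -/
def develop : Lam → Lam
  | var n => var n
  | app (lam t) u => (develop t).subst (single (develop u))
  | app (var n) u => app (var n) (develop u)
  | app (app t s) u => app (develop (app t s)) (develop u)
  | lam t => lam (develop t)

/-- Takahashi's triangle property: the complete development depends on `t` alone, so it closes every
diamond of parallel reductions from `t` at once. -/
theorem Par.develop {t u : Lam} (h : Par t u) : Par u t.develop := by
  induction h with
  | var n => exact .var n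
  | @app t t' u u' ht hu iht ihu =>
    cases t with
    | var n => exact .app iht ihu
    | app t s => exact .app iht ihu
    | lam t =>
      cases ht with
      | lam ht =>
        cases iht with
        | lam iht => exact .beta iht ihu
  | lam _ ih => exact .lam ih
  | beta _ _ iht ihu => exact iht.subst_single ihu

theorem BetaRed.confluent {t u v : Lam} (hu : t.BetaRed u) (hv : t.BetaRed v) :
    ∃ s, u.BetaRed s ∧ v.BetaRed s := by
  have toPar : ∀ {a b : Lam}, a.BetaRed b → Relation.ReflTransGen Par a b := fun h =>
    Relation.ReflTransGen.mono (fun _ _ => BetaStep.par) _ _ h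
  have ofPar : ∀ {a b : Lam}, Relation.ReflTransGen Par a b → a.BetaRed b := fun h => by
    induction h with
    | refl => exact .refl
    | tail _ h ih => exact ih.trans h.betaRed
  obtain ⟨s, hs, hs'⟩ := Relation.church_rosser
    (fun a b c hb hc => ⟨a.develop, .single hb.develop, .single hc.develop⟩) (toPar hu) (toPar hv)
  exact ⟨s, ofPar hs, ofPar hs'⟩

theorem BetaEq.exists_common {t u : Lam} (h : t.BetaEq u) :
    ∃ s, t.BetaRed s ∧ u.BetaRed s := by
  induction h with
  | rel t u h => exact ⟨u, .single h, .refl⟩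
  | refl t => exact ⟨t, .refl, .refl⟩
  | symm t u _ ih =>
    obtain ⟨s, h₁, h₂⟩ := ih
    exact ⟨s, h₂, h₁⟩
  | trans t u v _ _ ih₁ ih₂ =>
    obtain ⟨a, ha, ha'⟩ := ih₁
    obtain ⟨b, hb, hb'⟩ := ih₂
    obtain ⟨s, hs, hs'⟩ := ha'.confluent hb
    exact ⟨s, ha.trans hs, hb'.trans hs'⟩

/-! ### Normal terms -/

theorem Normal.eq_of_betaRed {t u : Lam} (ht : t.Normal) (h : t.BetaRed u) : u = t := by
  rcases Relation.ReflTransGen.cases_head h with h | ⟨s, h, _⟩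
  · exact h.symm
  · exact absurd h (ht s)

theorem BetaRed.betaRed_normal {t u v : Lam} (hu : t.BetaRed u) (hv : t.BetaRed v)
    (hn : v.Normal) : u.BetaRed v := by
  obtain ⟨s, hs, hs'⟩ := hu.confluent hv
  rwa [hn.eq_of_betaRed hs'] at hs

theorem BetaRed.normal_unique {t u v : Lam} (hu : t.BetaRed u) (hv : t.BetaRed v)
    (hun : u.Normal) (hvn : v.Normal) : v = u :=
  hun.eq_of_betaRed (hu.betaRed_normal hv hvn)

theorem Normal.of_rename {t : Lam} {ρ : ℕ → ℕ} (h : (t.rename ρ).Normal) : t.Normal :=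
  fun _ hu => h _ (hu.rename ρ)

theorem Normal.rename {t : Lam} (h : t.Normal) (ρ : ℕ → ℕ) : (t.rename ρ).Normal := by
  intro u hu
  obtain ⟨t', ht, -⟩ := hu.of_rename
  exact h t' ht

theorem Normal.lam {t : Lam} (h : t.Normal) : (lam t).Normal := by
  rintro _ (_ | _ | _ | hu)
  exact h _ hu

theorem Normal.of_lam {t : Lam} (h : (Lam.lam t).Normal) : t.Normal :=
  fun _ hu => h _ (.lam hu)

theorem Normal.var (n : ℕ) : (var n).Normal := fun _ h => by cases h

/-- The term is not an abstraction. -/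
def NotLam (t : Lam) : Prop := ∀ r, t ≠ lam r

theorem Normal.app {t u : Lam} (ht : t.Normal) (hu : u.Normal) (h : t.NotLam) :
    (app t u).Normal := by
  intro s hs
  cases hs with
  | beta r => exact h r rfl
  | appL _ hs => exact ht _ hs
  | appR _ hs => exact hu _ hs

/-- Follow the reduction of `s` applied to `y`. It stays inside `s` unless `s` becomes an
abstraction that is contracted against `y`; from there on it reduces a renaming of the body, and
such a reduction lifts to the body itself. -/
theorem BetaRed.normalizable_of_app_var {w N : Lam} (h : w.BetaRed N) (hN : N.Normal) {y : ℕ}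
    {s : Lam} (hw : w = app s (var y)) : s.Normalizable := by
  induction h using Relation.ReflTransGen.head_induction_on generalizing s with
  | refl =>
    subst hw
    exact ⟨s, .refl, fun u hu => hN _ (.appL _ hu)⟩
  | head hstep hred ih =>
    subst hw
    cases hstep with
    | beta r =>
      rw [subst_single_var] at hred
      obtain ⟨r', hr, rfl⟩ := BetaRed.of_rename hred
      exact ⟨_, hr.lam, hN.of_rename.lam⟩
    | appL _ hs =>
      obtain ⟨u, hu, hn⟩ := ih rfl
      exact ⟨u, hu.head hs, hn⟩
    | appR _ hs => cases hs

/-- The converse direction, with control of free variables: at most one contraction is needed, and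
`y` is the only variable that can be added. -/
theorem Normal.exists_app_var {s : Lam} (hs : s.Normal) (y : ℕ) :
    ∃ N : Lam, (Lam.app s (Lam.var y)).BetaRed N ∧ N.Normal ∧ s.Fv ⊆ N.Fv ∧
      N.Fv ⊆ s.Fv ∪ {y} := by
  by_cases h : s.NotLam
  · exact ⟨_, .refl, hs.app (.var y) h, Set.subset_union_left, subset_rfl⟩
  · obtain ⟨r, rfl⟩ : ∃ r, s = Lam.lam r := by simpa [NotLam] using h
    refine ⟨_, .single (.beta r _), ?_, ?_, (BetaStep.beta r (Lam.var y)).Fv_subset⟩ <;>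
      rw [subst_single_var]
    · exact hs.of_lam.rename _
    · exact fun k hk => mem_Fv_rename.2 ⟨k + 1, hk, rfl⟩

/-! ### Countability -/

/-- An injective numbering of the terms. -/
def code : Lam → ℕ
  | var n => 3 * n
  | app t u => 3 * Nat.pair t.code u.code + 1
  | lam t => 3 * t.code + 2

theorem code_injective : Function.Injective code := by
  intro t
  induction t with
  | var n =>
    intro u h
    cases u with
    | var m =>
      simp only [code] at h
      rw [show n = m by lia]
    | app _ _ | lam _ =>
      simp only [code] at h
      lia
  | app t s iht ihs =>
    intro u h
    cases u with
    | app t' s' =>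
      simp only [code] at h
      have h' := Nat.pair_eq_pair.1 (show Nat.pair t.code s.code = Nat.pair t'.code s'.code by lia)
      rw [iht h'.1, ihs h'.2]
    | var _ | lam _ =>
      simp only [code] at h
      lia
  | lam t ih =>
    intro u h
    cases u with
    | lam t' =>
      simp only [code] at h
      rw [ih (show t.code = t'.code by lia)]
    | var _ | app _ _ =>
      simp only [code] at h
      lia

instance : Nonempty Lam := ⟨var 0⟩

end Lam

open Lam

/-! ### Saturated sets -/

theorem Saturated.arrow {G G' : Set Lam} (h : Saturated G') : Saturated (arrow G G') :=
  fun _ _ hu htu s hs => h _ _ (hu s hs) (htu.appL s)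

theorem Saturated.sInter {S : Set (Set Lam)} (h : ∀ G ∈ S, Saturated G) : Saturated (⋂₀ S) :=
  fun t u hu htu G hG => h G hG t u (hu G hG) htu

theorem adequate_saturated : Adequate {G | Saturated G} where
  saturated _ h := h
  arrow_mem _ _ _ h := h.arrow
  sInter_mem _ h := Saturated.sInter h

theorem Model.saturated_val {L : FirstOrder.Language.{u, v}} (M : Model.{u, v, w} L)
    (A : Form L) (I : M.IntI) (J : M.IntR) : Saturated (M.val A I J) := by
  induction A generalizing I J with
  | rel P ts => exact M.adequate.saturated _ (M.rel P _).2
  | rvar n X ts => exact M.adequate.saturated _ (J n X _).2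
  | imp A B _ ihB => exact (ihB I J).arrow
  | all1 A ih => exact Saturated.sInter (by rintro _ ⟨a, rfl⟩; exact ih _ _)
  | all2 n A ih => exact Saturated.sInter (by rintro _ ⟨Φ, rfl⟩; exact ih _ _)

/-! ### The model of named realizers

A variable `k` is read as a name of the term `σ k`, except that the variables in `bad` are
excluded and that the variable `j` stands for an unspecified realizer of every type. -/

section Named

variable (σ : ℕ → Lam) (bad : Set ℕ) (j : ℕ)

/-- The normal terms without excluded variables that belong to `G` once names are replaced by what
they name, or that contain the unspecified realizer. -/
structure NamedIn (G : Set Lam) (s : Lam) : Prop where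
  normal : s.Normal
  disjoint : ∀ k ∈ s.Fv, k ∉ bad
  mem : j ∉ s.Fv → s.subst σ ∈ G

/-- The terms that reduce to an element of `NamedIn σ bad j G`. -/
def named (G : Set Lam) : Set Lam := {s | ∃ s', s.BetaRed s' ∧ NamedIn σ bad j G s'}

theorem saturated_named (G : Set Lam) : Saturated (named σ bad j G) := by
  rintro t u ⟨s, hs, hs'⟩ htu
  exact ⟨s, Relation.ReflTransGen.trans htu hs, hs'⟩

namespace Model

variable {L : FirstOrder.Language.{u, v}} (M : Model.{u, v, w} L)

/-- The model with the same base as `M` in which the value of an atomic formula is the set of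
the terms that reduce to a normal term naming an element of its value in `M`. -/
def namedModel : Model.{u, v, w} L where
  Base := M.Base
  nonempty := M.nonempty
  R := {G | Saturated G}
  adequate := adequate_saturated
  func := M.func
  rel P a := ⟨named σ bad j (M.rel P a), saturated_named σ bad j _⟩

/-- The interpretation of relation variables in the model of named realizers. -/
def namedIntR (J : M.IntR) : (M.namedModel σ bad j).IntR :=
  fun n X a => ⟨named σ bad j (J n X a), saturated_named σ bad j _⟩

theorem namedModel_termVal (I : M.IntI) (t : L.Term ℕ) :
    (M.namedModel σ bad j).termVal I t = M.termVal I t := by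
  induction t with
  | var x => rfl
  | func f ts ih => exact congrArg (M.func f) (funext ih)

theorem namedModel_satisfies {E : Set (L.Term ℕ × L.Term ℕ)} (h : M.Satisfies E) :
    (M.namedModel σ bad j).Satisfies E := by
  intro e he I
  exact (M.namedModel_termVal σ bad j I e.1).trans
    ((h e he I).trans (M.namedModel_termVal σ bad j I e.2).symm)

theorem namedModel_val_atomic {A : Form L} (hA : A.IsAtomic) (I : M.IntI) (J : M.IntR) :
    (M.namedModel σ bad j).val A I (M.namedIntR σ bad j J) = named σ bad j (M.val A I J) := by
  cases A with
  | rel P ts =>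
    simp only [val, namedModel_termVal]
    rfl
  | rvar n X ts =>
    simp only [val, namedModel_termVal]
    rfl
  | imp A B => exact hA.elim
  | all1 A => exact hA.elim
  | all2 n A => exact hA.elim

theorem namedIntR_pushR (n : ℕ) (Φ : (Fin n → M.Base) → M.R) (J : M.IntR) :
    (M.namedModel σ bad j).pushR n
        (fun a => ⟨named σ bad j (Φ a), saturated_named σ bad j _⟩) (M.namedIntR σ bad j J) =
      M.namedIntR σ bad j (M.pushR n Φ J) := by
  funext m X a
  by_cases hm : m = n
  · subst hm
    cases X <;> simp [pushR, namedIntR]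
  · simp [pushR, namedIntR, Function.update_of_ne hm]

-- Passing between `M` and the model of named realizers

variable {σ bad j}

/-- Variables are normal non-abstractions, so they serve as arguments: applying `s` to `j` yields
normalizability and the absence of excluded variables, and applying it to a name of each element of
the domain yields membership. -/
theorem named_of_val_imp (hj : j ∉ bad) (hσ : ∀ v, ∃ y, y ≠ j ∧ y ∉ bad ∧ σ y = v)
    {A B : Form L} {I : M.IntI} {J : M.IntR}
    (hB : ∀ s : Lam, s.NotLam → NamedIn σ bad j (M.val B I J) s →
      s ∈ (M.namedModel σ bad j).val B I (M.namedIntR σ bad j J))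
    (hA : (M.namedModel σ bad j).val A I (M.namedIntR σ bad j J) ⊆ named σ bad j (M.val A I J)) :
    (M.namedModel σ bad j).val (.imp B A) I (M.namedIntR σ bad j J) ⊆
      named σ bad j (M.val (.imp B A) I J) := by
  intro s hs
  have hvar : ∀ y, y ∉ bad → (y ≠ j → σ y ∈ M.val B I J) →
      ∃ N, (app s (var y)).BetaRed N ∧ NamedIn σ bad j (M.val A I J) N := fun y hy hmem =>
    hA (hs _ (hB (var y) (fun r => by simp)
      ⟨.var y, by rintro _ rfl; exact hy, fun h => hmem fun e => h e.symm⟩))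
  -- The wildcard is available even if the value of `B` in `M` is empty.
  obtain ⟨N, hN, hN'⟩ := hvar j hj fun h => absurd rfl h
  obtain ⟨s', hs', hn⟩ := hN.normalizable_of_app_var hN'.normal rfl
  refine ⟨s', hs', hn, fun k hk => ?_, fun hjs v hv => ?_⟩
  · obtain ⟨N₁, hN₁, hn₁, hsub, -⟩ := hn.exists_app_var j
    obtain rfl := hN.normal_unique ((hs'.appL _).trans hN₁) hN'.normal hn₁
    exact hN'.disjoint k (hsub hk)
  · obtain ⟨y, hyj, hy, rfl⟩ := hσ v
    obtain ⟨N₂, hN₂, hN₂'⟩ := hvar y hy fun _ => hv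
    obtain ⟨N₁, hN₁, hn₁, -, hsub⟩ := hn.exists_app_var y
    obtain rfl := hN₂.normal_unique ((hs'.appL _).trans hN₁) hN₂'.normal hn₁
    -- The normal form of `s'` applied to `y` avoids `j`, so its image under `σ` is in the value of
    -- `A`. The image of `s'` applied to `σ y` reduces to it, and the value is saturated.
    refine M.saturated_val A I J _ _ (hN₂'.mem fun h => ?_) (hN₁.subst σ)
    rcases hsub h with h | h
    · exact hjs h
    · exact hyj h.symm

/-- Instantiating the quantifier only at named versions of predicates `Φ` of `M` suffices. Each `Φ`
provides a normal form of `s`, and uniqueness makes it the same one for all of them. -/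
theorem named_of_val_all2 {n : ℕ} {A : Form L} {I : M.IntI} {J : M.IntR}
    (hA : ∀ J : M.IntR, (M.namedModel σ bad j).val A I (M.namedIntR σ bad j J) ⊆
      named σ bad j (M.val A I J)) :
    (M.namedModel σ bad j).val (.all2 n A) I (M.namedIntR σ bad j J) ⊆
      named σ bad j (M.val (.all2 n A) I J) := by
  intro s hs
  have hΦ : ∀ Φ : (Fin n → M.Base) → M.R, s ∈ named σ bad j (M.val A I (M.pushR n Φ J)) := by
    intro Φ
    apply hA
    rw [← namedIntR_pushR]
    exact Set.mem_iInter.1 hs _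
  -- Any predicate would do to obtain the normal form; the empty intersection, that is `Λ`, always
  -- belongs to `R`.
  obtain ⟨s', hs', h'⟩ := hΦ fun _ => ⟨⋂₀ ∅, M.adequate.sInter_mem _ (Set.empty_subset _)⟩
  refine ⟨s', hs', h'.normal, h'.disjoint, fun hjs => Set.mem_iInter.2 fun Φ => ?_⟩
  obtain ⟨s'', hs'', h''⟩ := hΦ Φ
  obtain rfl := hs'.normal_unique hs'' h'.normal h''.normal
  exact h''.mem hjs

/-- Replace the argument by its normal form, which saturation allows. Since `s` is not an
abstraction, the application is again normal and not an abstraction, so the hypothesis on `A`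
applies. -/
theorem val_imp_of_namedIn {A B : Form L} {I : M.IntI} {J : M.IntR}
    (hB : (M.namedModel σ bad j).val B I (M.namedIntR σ bad j J) ⊆ named σ bad j (M.val B I J))
    (hA : ∀ s : Lam, s.NotLam → NamedIn σ bad j (M.val A I J) s →
      s ∈ (M.namedModel σ bad j).val A I (M.namedIntR σ bad j J))
    {s : Lam} (hs : s.NotLam) (h : NamedIn σ bad j (M.val (.imp B A) I J) s) :
    s ∈ (M.namedModel σ bad j).val (.imp B A) I (M.namedIntR σ bad j J) := by
  intro r hr
  obtain ⟨r', hr', h'⟩ := hB hr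
  refine saturated_val _ _ _ _ _ (app s r') (hA _ (fun q => by simp) ⟨?_, ?_, ?_⟩) (hr'.appR s)
  · exact h.normal.app h'.normal hs
  · rintro k (hk | hk)
    · exact h.disjoint k hk
    · exact h'.disjoint k hk
  · exact fun hjs => h.mem (fun hk => hjs (Or.inl hk)) _ (h'.mem fun hk => hjs (Or.inr hk))

/-- In the model of named realizers, the elements of a positive type name elements of its value in
`M`, and the normal terms that name elements of the value of a negative type in `M` and are not
abstractions belong to it. -/
theorem namedModel_val (hj : j ∉ bad) (hσ : ∀ v, ∃ y, y ≠ j ∧ y ∉ bad ∧ σ y = v) (A : Form L) :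
    (A.IsPos → ∀ (I : M.IntI) (J : M.IntR),
      (M.namedModel σ bad j).val A I (M.namedIntR σ bad j J) ⊆ named σ bad j (M.val A I J)) ∧
    (A.IsNeg → ∀ (I : M.IntI) (J : M.IntR) (s : Lam), s.NotLam →
      NamedIn σ bad j (M.val A I J) s →
        s ∈ (M.namedModel σ bad j).val A I (M.namedIntR σ bad j J)) := by
  induction A with
  | rel P ts =>
    have hval := M.namedModel_val_atomic σ bad j (A := .rel P ts) trivial
    exact ⟨fun _ I J => (hval I J).subset, fun _ I J s _ h => (hval I J).superset ⟨s, .refl, h⟩⟩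
  | rvar n X ts =>
    have hval := M.namedModel_val_atomic σ bad j (A := .rvar n X ts) trivial
    exact ⟨fun _ I J => (hval I J).subset, fun _ I J s _ h => (hval I J).superset ⟨s, .refl, h⟩⟩
  | imp B A ihB ihA =>
    refine ⟨fun hA I J => ?_, fun hA I J s hs h => ?_⟩
    · cases hA with
      | atom h => exact h.elim
      | imp hB hA => exact M.named_of_val_imp hj hσ (ihB.2 hB I J) (ihA.1 hA I J)
    · cases hA with
      | atom h => exact h.elim
      | imp hB hA _ => exact M.val_imp_of_namedIn (ihB.1 hB I J) (ihA.2 hA I J) hs h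
  | all1 A ih =>
    refine ⟨fun hA => ?_, fun hA I J s hs h => ?_⟩
    · cases hA with
      | atom h => exact h.elim
    · cases hA with
      | atom h => exact h.elim
      | all1 hA =>
        -- Both intersections range over the same base.
        refine Set.mem_iInter.2 fun a => ih.2 hA (M.pushI a I) J s hs
          ⟨h.normal, h.disjoint, fun hjs => Set.mem_iInter.1 (h.mem hjs) a⟩
  | all2 n A ih =>
    refine ⟨fun hA I J => ?_, fun hA => ?_⟩
    · cases hA with
      | atom h => exact h.elim
      | all2 _ hA => exact M.named_of_val_all2 fun J => ih.1 hA I J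
    -- A second-order quantifier cannot head a negative type; its value in the new model would range
    -- over all saturated predicates, not just the named ones.
    · cases hA with
      | atom h => exact h.elim

end Model

end Named

/-! ### Values of positive types -/

/-- A uniform element of a positive type reduces to a closed normal term that belongs to the value
of the type in every model of the equations. -/
theorem exists_closed_normal_mem_val {L : FirstOrder.Language.{u, v}}
    {E : Set (L.Term ℕ × L.Term ℕ)} {A : Form L} (hA : A.IsPos) {t : Lam}
    (ht : t ∈ betaVal.{u, v, w} E A) (M : Model.{u, v, w} L) (hM : M.Satisfies E)
    (I : M.IntI) (J : M.IntR) :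
    ∃ s : Lam, t.BetaRed s ∧ s.Normal ∧ s.Closed ∧ s ∈ M.val A I J := by
  obtain ⟨N, hN⟩ := t.finite_Fv.bddAbove
  -- The variables `0, …, N` are excluded and `N + 1` is the wildcard, so names start at `N + 2`:
  -- the term `v` is named by `v.code + (N + 2)`.
  let σ : ℕ → Lam := fun k => Function.invFun code (k - (N + 2))
  have hσ : ∀ v, ∃ y, y ≠ N + 1 ∧ y ∉ Set.Iic N ∧ σ y = v := fun v =>
    ⟨v.code + (N + 2), by lia, by simp; lia, by
      simpa only [σ, Nat.add_sub_cancel] using Function.leftInverse_invFun code_injective v⟩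
  obtain ⟨s, hts, hs⟩ := (M.namedModel_val (bad := Set.Iic N) (j := N + 1) (by simp) hσ A).1 hA I J
    (ht _ (M.namedModel_satisfies σ _ _ hM) I _)
  have hc : s.Closed := Set.eq_empty_iff_forall_notMem.2 fun k hk =>
    hs.disjoint k hk (hN (hts.Fv_subset hk))
  refine ⟨s, hts, hs.normal, hc, ?_⟩
  rw [← hc.subst_eq σ]
  exact hs.mem fun h => by rw [Closed] at hc; simp [hc] at h

/-- The model with one individual in which every atomic formula has the value `Λ`. -/
def trivialModel (L : FirstOrder.Language.{u, v}) : Model.{u, v, w} L where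
  Base := PUnit
  nonempty := inferInstance
  R := {G | Saturated G}
  adequate := adequate_saturated
  func _ _ := PUnit.unit
  rel _ _ := ⟨Set.univ, fun _ _ _ _ => trivial⟩

end AF2

/-- The argument works for all positive types: neither the condition (*) nor the closedness of the
type is used, since the terms are compared with their normal forms through models on a given base
instead of through typability. -/
theorem mainTheorem6 {L : FirstOrder.Language.{u, v}} (E : Set (L.Term ℕ × L.Term ℕ))
    (A : AF2.Form L) (hclosed : A.Closed) (hgood : A.IsGoodPos E) :
    (∀ t ∈ AF2.betaVal.{u, v, w} E A,
      t.Normalizable ∧ ∃ u : AF2.Lam, t.BetaRed u ∧ u.Closed) ∧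
    (∀ t t' : AF2.Lam, t ∈ AF2.betaVal.{u, v, w} E A → t.BetaEq t' →
      t' ∈ AF2.betaVal.{u, v, w} E A) := by
  refine ⟨fun t ht => ?_, fun t t' ht htt' M hM I J => ?_⟩
  -- Some model of `E` is needed here; with a single individual, all equations hold.
  · obtain ⟨s, hts, hn, hc, -⟩ := AF2.exists_closed_normal_mem_val hgood.1 ht
      (AF2.trivialModel.{u, v, w} L) (fun _ _ _ => rfl) (fun _ => PUnit.unit)
      fun _ _ _ => ⟨Set.univ, fun _ _ _ _ => trivial⟩
    exact ⟨⟨s, hts, hn⟩, s, hts, hc⟩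
  · obtain ⟨s, hts, hn, -, hs⟩ := AF2.exists_closed_normal_mem_val hgood.1 ht M hM I J
    obtain ⟨r, hr, hr'⟩ := htt'.exists_common
    -- The common reduct `r` of `t` and `t'` still reduces to the normal form `s` of `t`.
    exact M.saturated_val A I J t' s hs (hr'.trans (hr.betaRed_normal hts hn))
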